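/- Call a subset of the Euclidean space $\mathbb{R}^n$ a circle if it is a round circle (of positive radius), a straight line or a point. A rounding is an analytic germ $\Phi:(\mathbb{R}^m,0)\to(\mathbb{R}^n,0)$ such that for every line $\ell$ through $0$ in $\mathbb{R}^m$ the image of the germ of $\ell$ at $0$ lies in a circle; its rank is the rank of its differential at $0$. Two roundings $\Phi_1,\Phi_2$ are equivalent if for every line $\ell$ through $0$ the images of the germ of $\ell$ under $\Phi_1$ and $\Phi_2$ lie in one and the same circle. Theorem. Every rounding $\Phi$ of rank at least $2$ is equivalent to a fractional quadratic rounding of rank at least $2$, that is, a rounding of the form $P/Q$ near $0$, where the coordinates of $P$ are polynomials of degree at most $2$ and $Q$ is a polynomial of degree at most $2$ with $Q(0)\neq 0$. Explicitly, suppose that $\Phi(x)=A(x)+B(x)+o(|x|^2)$ as $x\to0$, with $A:\mathbb{R}^m\to\mathbb{R}^n$ linear and $B:\mathbb{R}^m\to\mathbb{R}^n$ homogeneous quadratic. Then the polynomials $\langle A,B\rangle$ and $\langle B,B\rangle$ are divisible by $\langle A,A\rangle$, so that there are a linear form $p$ and a quadratic form $q$ on $\mathbb{R}^m$ with $\langle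 A,B\rangle=p\,\langle A,A\rangle$ and $\langle B,B\rangle=q\,\langle A,A\rangle$, and $$\Psi=\frac{A+B-2pA}{1-2p+q}$$ is a fractional quadratic rounding of rank at least $2$ that is equivalent to $\Phi$. -/

import Mathlib

open Filter Topology Asymptotics

/-- A circle in the Euclidean space `ℝⁿ`: a point, a straight line, or a round circle, i.e. the
intersection of a sphere of positive radius with an affine 2-plane through its centre. -/
def IsCircle {n : ℕ} (C : Set (EuclideanSpace ℝ (Fin n))) : Prop :=
  (∃ c, C = {c}) ∨
  (∃ L : AffineSubspace ℝ (EuclideanSpace ℝ (Fin n)),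
    (L : Set (EuclideanSpace ℝ (Fin n))).Nonempty ∧
      Module.finrank ℝ L.direction = 1 ∧ C = L) ∨
  (∃ (S : AffineSubspace ℝ (EuclideanSpace ℝ (Fin n))) (c : EuclideanSpace ℝ (Fin n)) (r : ℝ),
    c ∈ S ∧ Module.finrank ℝ S.direction = 2 ∧ 0 < r ∧
      C = (S : Set (EuclideanSpace ℝ (Fin n))) ∩ Metric.sphere c r)

/-- `Φ` maps the germ at `0` of the vector line spanned by `v` into `C`. -/
def MapsLineGermInto {m n : ℕ} (Φ : EuclideanSpace ℝ (Fin m) → EuclideanSpace ℝ (Fin n))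
    (v : EuclideanSpace ℝ (Fin m)) (C : Set (EuclideanSpace ℝ (Fin n))) : Prop :=
  ∀ᶠ t : ℝ in 𝓝 0, Φ (t • v) ∈ C

/-- `Φ` represents an analytic germ `(ℝᵐ, 0) → (ℝⁿ, 0)` taking every germ of a vector line to a
germ of a circle. (The rank is not part of this definition.) -/
def IsRounding {m n : ℕ} (Φ : EuclideanSpace ℝ (Fin m) → EuclideanSpace ℝ (Fin n)) : Prop :=
  AnalyticAt ℝ Φ 0 ∧ Φ 0 = 0 ∧
    ∀ v : EuclideanSpace ℝ (Fin m), v ≠ 0 → ∃ C, IsCircle C ∧ MapsLineGermInto Φ v C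

/-- The rank of the first differential at `0`. -/
noncomputable def rankAtZero {m n : ℕ}
    (Φ : EuclideanSpace ℝ (Fin m) → EuclideanSpace ℝ (Fin n)) : ℕ :=
  Module.finrank ℝ (LinearMap.range (fderiv ℝ Φ 0).toLinearMap)

/-- For every vector line, its germ is sent by `Φ₁` and by `Φ₂` into one and the same circle. -/
def RoundingEquiv {m n : ℕ}
    (Φ₁ Φ₂ : EuclideanSpace ℝ (Fin m) → EuclideanSpace ℝ (Fin n)) : Prop :=
  ∀ v : EuclideanSpace ℝ (Fin m), v ≠ 0 →
    ∃ C, IsCircle C ∧ MapsLineGermInto Φ₁ v C ∧ MapsLineGermInto Φ₂ v C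

/-- The germ of `Ψ` at `0` is `P / Q`, where `P` is given in coordinates by polynomials of degree
at most two, and `Q` is a polynomial of degree at most two that does not vanish at `0`. -/
def IsFractionalQuadratic {m n : ℕ}
    (Ψ : EuclideanSpace ℝ (Fin m) → EuclideanSpace ℝ (Fin n)) : Prop :=
  ∃ (P : Fin n → MvPolynomial (Fin m) ℝ) (Q : MvPolynomial (Fin m) ℝ),
    (∀ i, (P i).totalDegree ≤ 2) ∧ Q.totalDegree ≤ 2 ∧
    MvPolynomial.eval (fun _ => (0 : ℝ)) Q ≠ 0 ∧
    ∀ᶠ x : EuclideanSpace ℝ (Fin m) in 𝓝 0, ∀ i,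
      Ψ x i = MvPolynomial.eval (fun j => x j) (P i) / MvPolynomial.eval (fun j => x j) Q

/-- The 2-jet of `Φ` at `0` is `A + B`, with `A` linear and `B` homogeneous quadratic. -/
def HasTwoJet {m n : ℕ} (Φ : EuclideanSpace ℝ (Fin m) → EuclideanSpace ℝ (Fin n))
    (A : EuclideanSpace ℝ (Fin m) →ₗ[ℝ] EuclideanSpace ℝ (Fin n))
    (B : QuadraticMap ℝ (EuclideanSpace ℝ (Fin m)) (EuclideanSpace ℝ (Fin n))) : Prop :=
  (fun x => Φ x - (A x + B x)) =o[𝓝 0] fun x => ‖x‖ ^ 2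

/-- The map `(A + B - 2pA) / (1 - 2p + q)`. -/
noncomputable def quadraticModel {m n : ℕ}
    (A : EuclideanSpace ℝ (Fin m) →ₗ[ℝ] EuclideanSpace ℝ (Fin n))
    (B : QuadraticMap ℝ (EuclideanSpace ℝ (Fin m)) (EuclideanSpace ℝ (Fin n)))
    (p : EuclideanSpace ℝ (Fin m) →ₗ[ℝ] ℝ) (q : QuadraticForm ℝ (EuclideanSpace ℝ (Fin m)))
    (x : EuclideanSpace ℝ (Fin m)) : EuclideanSpace ℝ (Fin n) :=
  (1 - 2 * p x + q x)⁻¹ • (A x + B x - (2 * p x) • A x)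

/-! Restrict the rounding to the line through `x`, so that it becomes a curve `t a + t² b + t³ c +
t⁴ d + …` in a circle, and put `s = ⟨a, a⟩`. Such a curve satisfies the equation of its osculating
circle, which is determined by `a` and `b` (`IsCircle.eventually_osculating`). The equation is kept
free of denominators and is trivial when `a = 0`. Its terms of orders three and four therefore hold
for every `x`, and are identities between polynomials in `x` (`osculating_coefficients`).

Rank at least two makes `s` a prime polynomial: over the reals, a factor of degree one would force
the linear part to vanish on a hyperplane. Reducing the two identities modulo `s` gives `s ∣ ⟨a,
b⟩²`, then `s ∣ ⟨c, a⟩`, then `s ∣ ⟨b, b⟩²` (`dvd_dotProduct_of_circle_conditions`), hence the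
quotients `p` and `q`.

These quotients give `|A + B - 2pA|² = (1 - 2p + q)|A|²`. Where `A x ≠ 0`, the inversion `y ↦ y /
|y|²` sends the model on that line to `(a / t + b - 2pa) / s`, a parametrised straight line. So the
model runs along a circle through `0`, and its second-order jet makes it the same osculating circle.
Where `A x = 0`, also `B x = 0`, and the model is constantly `0` on the line. -/

namespace MvPolynomial

/-! ### Homogeneous polynomials, and primality of the squared norm -/

theorem IsHomogeneous.exists_eq_mul_of_dvd {σ R : Type*} [CommRing R] {s f : MvPolynomial σ R}
    {i j : ℕ} (hs : s.IsHomogeneous i) (hf : f.IsHomogeneous (i + j)) (h : s ∣ f) :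
    ∃ g : MvPolynomial σ R, g.IsHomogeneous j ∧ f = s * g := by
  classical
  let _ := MvPolynomial.gradedAlgebra (σ := σ) (R := R)
  obtain ⟨g, rfl⟩ := h
  -- The degree `j` component of any cofactor already serves as a cofactor.
  refine ⟨_, (DirectSum.decompose (homogeneousSubmodule σ R) g j).2, ?_⟩
  have := DirectSum.coe_decompose_mul_of_left_mem_of_le (homogeneousSubmodule σ R)
    (a := s) (b := g) hs (Nat.le_add_right i j)
  rw [DirectSum.decompose_of_mem_same _ hf, Nat.add_sub_cancel_left] at this
  exact this

variable {m n : ℕ}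

theorem IsHomogeneous.exists_linearForm {f : MvPolynomial (Fin m) ℝ} (hf : f.IsHomogeneous 1) :
    ∃ p : EuclideanSpace ℝ (Fin m) →ₗ[ℝ] ℝ, ∀ x, p x = eval (fun j => x j) f := by
  rw [← mem_homogeneousSubmodule, homogeneousSubmodule_one_eq_span_X] at hf
  induction hf using Submodule.span_induction with
  | mem f hf =>
    obtain ⟨i, rfl⟩ := hf
    exact ⟨(EuclideanSpace.proj i : EuclideanSpace ℝ (Fin m) →L[ℝ] ℝ).toLinearMap, by simp⟩
  | zero => exact ⟨0, by simp⟩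
  | add f g _ _ hf hg =>
    obtain ⟨p, hp⟩ := hf
    obtain ⟨q, hq⟩ := hg
    exact ⟨p + q, by simp [hp, hq]⟩
  | smul a f _ hf =>
    obtain ⟨p, hp⟩ := hf
    exact ⟨a • p, by simp [hp, smul_eval]⟩

theorem IsHomogeneous.exists_quadraticForm {f : MvPolynomial (Fin m) ℝ} (hf : f.IsHomogeneous 2) :
    ∃ q : QuadraticForm ℝ (EuclideanSpace ℝ (Fin m)), ∀ x, q x = eval (fun j => x j) f := by
  rw [← mem_homogeneousSubmodule, ← homogeneousSubmodule_one_pow, pow_two] at hf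
  induction hf using Submodule.mul_induction_on' with
  | mem_mul_mem f hf g hg =>
    obtain ⟨p, hp⟩ := IsHomogeneous.exists_linearForm hf
    obtain ⟨q, hq⟩ := IsHomogeneous.exists_linearForm hg
    exact ⟨QuadraticMap.linMulLin p q, by simp [hp, hq]⟩
  | add f _ g _ hf hg =>
    obtain ⟨p, hp⟩ := hf
    obtain ⟨q, hq⟩ := hg
    exact ⟨p + q, by simp [hp, hq]⟩

theorem exists_eval_eq_of_continuousMultilinearMap {k : ℕ}
    (P : ContinuousMultilinearMap ℝ (fun _ : Fin k => EuclideanSpace ℝ (Fin m))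
      (EuclideanSpace ℝ (Fin n))) :
    ∃ f : Fin n → MvPolynomial (Fin m) ℝ, (∀ i, (f i).IsHomogeneous k) ∧
      ∀ (x : EuclideanSpace ℝ (Fin m)) (i : Fin n),
        P (fun _ => x) i = eval (fun j => x j) (f i) := by
  classical
  refine ⟨fun i => ∑ s : Fin k → Fin m,
    C (P (fun l => EuclideanSpace.single (s l) (1 : ℝ)) i) * ∏ l, X (s l), fun i => ?_,
    fun x i => ?_⟩
  · refine IsHomogeneous.sum _ _ _ fun s _ => IsHomogeneous.C_mul ?_ _
    simpa using IsHomogeneous.prod Finset.univ (fun l => (X (s l) : MvPolynomial (Fin m) ℝ))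
      (fun _ => 1) fun l _ => isHomogeneous_X ℝ (s l)
  · have hx : x = ∑ j, x j • EuclideanSpace.single j (1 : ℝ) := by
      ext l
      simp [Pi.single_apply]
    conv_lhs => rw [hx]
    have h := P.toMultilinearMap.map_sum
      (fun (_ : Fin k) (j : Fin m) => x j • EuclideanSpace.single j (1 : ℝ))
    simp only [ContinuousMultilinearMap.coe_coe] at h
    rw [h]
    simp only [map_sum, map_mul, map_prod, eval_C, eval_X, WithLp.ofLp_sum, Finset.sum_apply]
    refine Finset.sum_congr rfl fun s _ => ?_
    have := P.toMultilinearMap.map_smul_univ (fun l => x (s l))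
      (fun l => EuclideanSpace.single (s l) (1 : ℝ))
    simp only [ContinuousMultilinearMap.coe_coe] at this
    rw [this]
    simp [mul_comm]

/-- An affine form that is not constant vanishes on an affine hyperplane. -/
theorem exists_eval_eq_zero_of_totalDegree_eq_one {f : MvPolynomial (Fin m) ℝ}
    (hf : f.totalDegree = 1) :
    ∃ (l : EuclideanSpace ℝ (Fin m) →ₗ[ℝ] ℝ) (x₀ : EuclideanSpace ℝ (Fin m)),
      ∀ x, l x = 0 → eval (fun j => (x₀ + x) j) f = 0 := by
  obtain ⟨l, hl⟩ := (homogeneousComponent_isHomogeneous 1 f).exists_linearForm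
  have hsum : f = C (coeff 0 f) + homogeneousComponent 1 f := by
    conv_lhs => rw [← sum_homogeneousComponent f, hf]
    simp [Finset.sum_range_succ]
  have heval : ∀ x : EuclideanSpace ℝ (Fin m), eval (fun j => x j) f = coeff 0 f + l x := by
    intro x
    rw [hl]
    conv_lhs => rw [hsum]
    simp
  have hne : ∃ y, l y ≠ 0 := by
    by_contra! h
    have h1 : homogeneousComponent 1 f = 0 := by
      refine MvPolynomial.funext fun y => ?_
      simpa [h] using (hl (WithLp.toLp 2 y)).symm
    rw [hsum, h1, add_zero, totalDegree_C] at hf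
    exact zero_ne_one hf
  obtain ⟨y, hy⟩ := hne
  refine ⟨l, (-(coeff 0 f) / l y) • y, fun x hx => ?_⟩
  rw [heval, map_add, map_smul, hx, smul_eq_mul, div_mul_cancel₀ _ hy]
  ring

/-- The squared norm of a linear map of rank at least two is a prime polynomial. -/
theorem prime_of_eval_eq_inner_self {s : MvPolynomial (Fin m) ℝ} (hs : s.IsHomogeneous 2)
    (A : EuclideanSpace ℝ (Fin m) →ₗ[ℝ] EuclideanSpace ℝ (Fin n))
    (hA : 2 ≤ Module.finrank ℝ (LinearMap.range A))
    (heval : ∀ x : EuclideanSpace ℝ (Fin m), eval (fun j => x j) s = inner ℝ (A x) (A x)) :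
    Prime s := by
  have hs0 : s ≠ 0 := by
    rintro rfl
    have : A = 0 := by
      ext1 x
      simpa using (heval x).symm
    subst this
    rw [LinearMap.range_zero, finrank_bot] at hA
    omega
  have hdeg : s.totalDegree = 2 := hs.totalDegree hs0
  -- A factor of degree one vanishes on a translate `x₀ + ker l`. Definiteness of the inner product
  -- makes `A` vanish there too, first at `x₀` and then on `ker l`, so its rank is at most one.
  have key : ∀ f g : MvPolynomial (Fin m) ℝ, s = f * g → f.totalDegree ≠ 1 := by
    rintro f g hfg hf
    obtain ⟨l, x₀, hl⟩ := exists_eval_eq_zero_of_totalDegree_eq_one hf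
    have hz : ∀ x, l x = 0 → A (x₀ + x) = 0 := by
      intro x hx
      have := heval (x₀ + x)
      rw [hfg, map_mul, hl x hx, zero_mul] at this
      exact inner_self_eq_zero.mp this.symm
    have h0 : A x₀ = 0 := by simpa using hz 0 (map_zero l)
    have hker : LinearMap.ker l ≤ LinearMap.ker A := by
      intro x hx
      have := hz x hx
      rwa [map_add, h0, zero_add] at this
    have h1 := LinearMap.finrank_range_add_finrank_ker l
    have h2 := LinearMap.finrank_range_add_finrank_ker A
    have h3 := Submodule.finrank_mono hker
    have h4 : Module.finrank ℝ (LinearMap.range l) ≤ 1 := by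
      simpa using Submodule.finrank_le (LinearMap.range l)
    omega
  have hunit : ∀ f : MvPolynomial (Fin m) ℝ, f ≠ 0 → f.totalDegree = 0 → IsUnit f := by
    intro f hf h
    rw [totalDegree_eq_zero_iff_eq_C] at h
    rw [h]
    refine (IsUnit.mk0 _ fun h0 => hf ?_).map C
    rw [h, h0, C_0]
  rw [← UniqueFactorizationMonoid.irreducible_iff_prime]
  refine ⟨fun h => ?_, fun f g hfg => ?_⟩
  · have := (isUnit_iff_totalDegree_of_isReduced.mp h).2
    omega
  · have hf0 : f ≠ 0 := by rintro rfl; simp [hs0] at hfg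
    have hg0 : g ≠ 0 := by rintro rfl; simp [hs0] at hfg
    have h1 := totalDegree_mul_of_isDomain hf0 hg0
    rw [← hfg, hdeg] at h1
    have h2 := key f g hfg
    by_cases h : f.totalDegree = 0
    · exact Or.inl (hunit f hf0 h)
    · exact Or.inr (hunit g hg0 (by omega))

end MvPolynomial

/-! ### Divisibility modulo a prime squared norm -/

/-- If vectors `a, b, c, d` over a domain satisfy the third and fourth order conditions for lying
on a circle, a prime `⟨a, a⟩` not dividing `a` divides `⟨a, b⟩` and `⟨b, b⟩`. -/
theorem dvd_dotProduct_of_circle_conditions {R ι : Type*} [CommRing R] [IsDomain R] [Fintype ι]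
    {a b c d : ι → R} {s : R} (hs : Prime s) (h2 : ¬ s ∣ 2) {i₀ : ι} (hi₀ : ¬ s ∣ a i₀)
    (hc : ∀ i, s ^ 2 * c i - s * (c ⬝ᵥ a) * a i = 2 * (a ⬝ᵥ b) * (s * b i - (a ⬝ᵥ b) * a i))
    (hd : ∀ i, s ^ 2 * d i - s * (d ⬝ᵥ a) * a i =
      (b ⬝ᵥ b + 2 * (a ⬝ᵥ c)) * (s * b i - (a ⬝ᵥ b) * a i)) :
    s ∣ a ⬝ᵥ b ∧ s ∣ b ⬝ᵥ b := by
  -- Modulo `s`, the third-order condition reads `2⟨a, b⟩² a i = 0`.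
  have hab : s ∣ a ⬝ᵥ b := by
    have : s ∣ 2 * (a ⬝ᵥ b) ^ 2 * a i₀ :=
      ⟨2 * (a ⬝ᵥ b) * b i₀ - s * c i₀ + (c ⬝ᵥ a) * a i₀, by linear_combination hc i₀⟩
    rcases hs.dvd_or_dvd this with h | h
    · rcases hs.dvd_or_dvd h with h | h
      · exact absurd h h2
      · exact hs.dvd_of_dvd_pow h
    · exact absurd h hi₀
  refine ⟨hab, ?_⟩
  obtain ⟨p, hp⟩ := hab
  -- With `⟨a, b⟩ = s p`, the third-order condition can be divided by `s`; modulo `s` what remains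
  -- is `⟨c, a⟩ a i = 0`.
  have hc' : s ∣ c ⬝ᵥ a := by
    have h := hc i₀
    rw [hp] at h
    have h' : s * c i₀ - (c ⬝ᵥ a) * a i₀ = 2 * (s * p) * (b i₀ - p * a i₀) :=
      mul_left_cancel₀ hs.ne_zero (by linear_combination h)
    have : s ∣ (c ⬝ᵥ a) * a i₀ := ⟨c i₀ - 2 * p * (b i₀ - p * a i₀), by linear_combination -h'⟩
    exact (hs.dvd_or_dvd this).resolve_right hi₀
  have hd' : ∀ i, s * d i - (d ⬝ᵥ a) * a i =
      (b ⬝ᵥ b + 2 * (a ⬝ᵥ c)) * (b i - p * a i) := by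
    intro i
    have h := hd i
    rw [hp] at h
    exact mul_left_cancel₀ hs.ne_zero (by linear_combination h)
  -- Pair the reduced fourth-order condition with `b`. Since `s` divides `⟨a, b⟩` and `⟨a, c⟩`, only
  -- `⟨b, b⟩²` survives modulo `s`.
  have hsum : s * (d ⬝ᵥ b) - (d ⬝ᵥ a) * (a ⬝ᵥ b) =
      (b ⬝ᵥ b + 2 * (a ⬝ᵥ c)) * (b ⬝ᵥ b - p * (a ⬝ᵥ b)) := by
    have : ∑ i, (s * d i - (d ⬝ᵥ a) * a i) * b i =
        ∑ i, (b ⬝ᵥ b + 2 * (a ⬝ᵥ c)) * (b i - p * a i) * b i :=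
      Finset.sum_congr rfl fun i _ => by rw [hd' i]
    calc s * (d ⬝ᵥ b) - (d ⬝ᵥ a) * (a ⬝ᵥ b) = ∑ i, (s * d i - (d ⬝ᵥ a) * a i) * b i := by
          conv_lhs => enter [1]; rw [dotProduct]
          conv_lhs => enter [2, 2]; rw [dotProduct]
          rw [Finset.mul_sum, Finset.mul_sum, ← Finset.sum_sub_distrib]
          exact Finset.sum_congr rfl fun i _ => by ring
      _ = ∑ i, (b ⬝ᵥ b + 2 * (a ⬝ᵥ c)) * (b i - p * a i) * b i := this
      _ = (b ⬝ᵥ b + 2 * (a ⬝ᵥ c)) * ∑ i, (b i * b i - p * (a i * b i)) := by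
          rw [Finset.mul_sum]
          exact Finset.sum_congr rfl fun i _ => by ring
      _ = _ := by
          rw [Finset.sum_sub_distrib, ← Finset.mul_sum]
          simp only [dotProduct]
  obtain ⟨r, hr⟩ := hc'
  rw [dotProduct_comm a c, hr, hp] at hsum
  refine hs.dvd_of_dvd_pow (n := 2) ⟨d ⬝ᵥ b - (d ⬝ᵥ a) * p - 2 * r * (b ⬝ᵥ b)
    + p ^ 2 * (b ⬝ᵥ b + 2 * s * r), ?_⟩
  linear_combination -hsum

/-! ### Comparison of coefficients in little-o expansions -/

section Asymptotics

variable {E : Type*} [NormedAddCommGroup E] [NormedSpace ℝ E]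

theorem eq_zero_of_pow_smul_isLittleO {k : ℕ} {v : E}
    (h : (fun t : ℝ => t ^ k • v) =o[𝓝 0] fun t : ℝ => t ^ k) : v = 0 := by
  by_contra hv
  have hpos : 0 < ‖v‖ := norm_pos_iff.mpr hv
  have h1 := (h.def (half_pos hpos)).filter_mono (nhdsWithin_le_nhds (s := {0}ᶜ))
  obtain ⟨t, ht, ht0⟩ := (h1.and self_mem_nhdsWithin).exists
  have htk : 0 < ‖t ^ k‖ := norm_pos_iff.mpr (pow_ne_zero _ ht0)
  rw [norm_smul] at ht
  nlinarith

/-- The `w` term is itself `o(t ^ k)`, so `v` drops out first and then `w`. -/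
theorem eq_zero_of_pow_smul_add_pow_smul_isLittleO {k : ℕ} {v w : E}
    (h : (fun t : ℝ => t ^ k • v + t ^ (k + 1) • w) =o[𝓝 0] fun t : ℝ => t ^ (k + 1)) :
    v = 0 ∧ w = 0 := by
  have hk : (fun t : ℝ => t ^ (k + 1)) =o[𝓝 0] fun t : ℝ => t ^ k :=
    isLittleO_pow_pow (Nat.lt_succ_self k)
  have hv : v = 0 := by
    refine eq_zero_of_pow_smul_isLittleO (k := k) ?_
    have hw : (fun t : ℝ => t ^ (k + 1) • w) =o[𝓝 0] fun t : ℝ => t ^ k := by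
      simpa using hk.smul_isBigO (isBigO_refl (fun _ : ℝ => w) (𝓝 0)) |>.trans_isBigO
        (isBigO_of_le' (c := ‖w‖) (g := fun t : ℝ => t ^ k) _ fun t => by
          rw [norm_smul, mul_comm])
    simpa using (h.trans hk).sub hw
  refine ⟨hv, eq_zero_of_pow_smul_isLittleO (k := k + 1) ?_⟩
  simpa [hv] using h

end Asymptotics

/-! ### Circles and the osculating equation -/

section Circle

variable {E : Type*} [NormedAddCommGroup E] [InnerProductSpace ℝ E]

/-- Polarise: the difference is `⟨F - P, (F - P) + 2P⟩`, a small vector against a bounded one. -/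
theorem inner_self_sub_inner_self_isLittleO {α : Type*} {l : Filter α} {F P : α → E} {g : α → ℝ}
    (hF : (fun t => F t - P t) =o[l] g) (hg : g =O[l] fun _ => (1 : ℝ))
    (hP : P =O[l] fun _ => (1 : ℝ)) :
    (fun t => (inner ℝ (F t) (F t) - inner ℝ (P t) (P t) : ℝ)) =o[l] g := by
  have h1 : (fun t => (F t - P t) + (2 : ℝ) • P t) =O[l] fun _ => (1 : ℝ) :=
    (hF.isBigO.trans hg).add (hP.const_smul_left 2)
  have h2 := hF.norm_left.mul_isBigO h1.norm_left
  simp only [mul_one] at h2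
  refine IsBigO.trans_isLittleO (isBigO_of_le l fun t => ?_) h2
  have : (inner ℝ (F t) (F t) - inner ℝ (P t) (P t) : ℝ) =
      inner ℝ (F t - P t) ((F t - P t) + (2 : ℝ) • P t) := by
    simp only [inner_add_right, inner_sub_right, inner_sub_left, inner_smul_right,
      real_inner_comm (F t) (P t)]
    ring
  rw [this, norm_mul, norm_norm, norm_norm]
  exact norm_inner_le_norm _ _

/-- Projecting to `Wᗮ` kills the curve, so the projected jet is `o(t ^ 2)`. -/
theorem twoJet_mem_submodule [FiniteDimensional ℝ E] {F : ℝ → E} {a b : E} (W : Submodule ℝ E)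
    (hF : (fun t => F t - (t • a + t ^ 2 • b)) =o[𝓝 0] fun t : ℝ => t ^ 2)
    (hW : ∀ᶠ t in 𝓝 0, F t ∈ W) : a ∈ W ∧ b ∈ W := by
  have h1 : (fun t : ℝ => t ^ 1 • Wᗮ.starProjection a + t ^ (1 + 1) • Wᗮ.starProjection b)
      =o[𝓝 0] fun t : ℝ => t ^ (1 + 1) := by
    refine IsLittleO.congr'
      ((Wᗮ.starProjection.isBigO_comp _ _).trans_isLittleO hF).neg_left ?_ EventuallyEq.rfl
    filter_upwards [hW] with t ht
    have : Wᗮ.starProjection (F t) = 0 := by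
      rw [Submodule.starProjection_apply_eq_zero_iff, Submodule.orthogonal_orthogonal]
      exact ht
    rw [map_sub, this, zero_sub, neg_neg, map_add, map_smul, map_smul, pow_one]
  have h2 := eq_zero_of_pow_smul_add_pow_smul_isLittleO h1
  simpa only [Submodule.starProjection_apply_eq_zero_iff, Submodule.orthogonal_orthogonal] using h2

/-- The hypothesis is the equation of the sphere through `0` centred at `c`; the conclusions are its
coefficients of orders one and two. -/
theorem twoJet_inner_centre {F : ℝ → E} {a b c : E}
    (hF : (fun t => F t - (t • a + t ^ 2 • b)) =o[𝓝 0] fun t : ℝ => t ^ 2)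
    (hc : ∀ᶠ t in 𝓝 0, inner ℝ (F t) (F t) = 2 * inner ℝ (F t) c) :
    inner ℝ a c = 0 ∧ inner ℝ a a = 2 * inner ℝ b c := by
  have hg : (fun t : ℝ => t ^ 2) =O[𝓝 0] fun _ => (1 : ℝ) :=
    (by fun_prop : Continuous fun t : ℝ => t ^ 2).continuousAt.isBigO_one ℝ
  have hP : (fun t : ℝ => t • a + t ^ 2 • b) =O[𝓝 0] fun _ => (1 : ℝ) :=
    (by fun_prop : Continuous fun t : ℝ => t • a + t ^ 2 • b).continuousAt.isBigO_one ℝ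
  have hq := inner_self_sub_inner_self_isLittleO hF hg hP
  have hl := ((innerSL ℝ c).isBigO_comp (fun t => F t - (t • a + t ^ 2 • b)) (𝓝 0)).trans_isLittleO
    hF |>.const_mul_left 2
  have hr : (fun t : ℝ => t ^ 3 * (2 * inner ℝ a b + t * inner ℝ b b)) =o[𝓝 0]
      fun t : ℝ => t ^ 2 := by
    simpa using (isLittleO_pow_pow (𝕜 := ℝ) (show 2 < 3 by norm_num)).mul_isBigO
      ((by fun_prop : Continuous fun t : ℝ =>
        2 * inner ℝ a b + t * inner ℝ b b).continuousAt.isBigO_one ℝ)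
  have h : (fun t : ℝ => t ^ 1 • (2 * inner ℝ a c : ℝ) +
      t ^ (1 + 1) • (2 * inner ℝ b c - inner ℝ a a : ℝ)) =o[𝓝 0] fun t : ℝ => t ^ (1 + 1) := by
    refine ((hq.sub hl).add hr).congr' ?_ EventuallyEq.rfl
    filter_upwards [hc] with t ht
    simp only [innerSL_apply_apply, inner_add_right, inner_sub_right, inner_add_left,
      inner_smul_left, inner_smul_right, RCLike.conj_to_real, smul_eq_mul, real_inner_comm a c,
      real_inner_comm b c, real_inner_comm (F t) c, real_inner_comm a b, ht]
    ring
  obtain ⟨h1, h2⟩ := eq_zero_of_pow_smul_add_pow_smul_isLittleO h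
  constructor <;> linarith

/-- A curve in a circle through `0` satisfies the equation of the osculating circle. -/
theorem IsCircle.eventually_osculating {n : ℕ} {C : Set (EuclideanSpace ℝ (Fin n))}
    (hC : IsCircle C) {F : ℝ → EuclideanSpace ℝ (Fin n)} {a b : EuclideanSpace ℝ (Fin n)}
    (hF : (fun t => F t - (t • a + t ^ 2 • b)) =o[𝓝 0] fun t : ℝ => t ^ 2)
    (hFC : ∀ᶠ t in 𝓝 0, F t ∈ C) (hF0 : F 0 = 0) :
    ∀ᶠ t in 𝓝 0, (inner ℝ a a : ℝ) ^ 2 • F t - ((inner ℝ a a : ℝ) * inner ℝ (F t) a) • a =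
      (inner ℝ (F t) (F t) : ℝ) • ((inner ℝ a a : ℝ) • b - (inner ℝ a b : ℝ) • a) := by
  have h0 : (0 : EuclideanSpace ℝ (Fin n)) ∈ C := hF0 ▸ hFC.self_of_nhds
  rcases eq_or_ne a 0 with rfl | ha
  · simp
  rcases hC with ⟨c, rfl⟩ | ⟨L, hL, hL1, rfl⟩ | ⟨S, c, r, hcS, hS2, hr, rfl⟩
  · exfalso
    rw [Set.mem_singleton_iff] at h0
    subst h0
    have := twoJet_mem_submodule ⊥ hF (by simpa using hFC)
    exact ha (by simpa using this.1)
  · have hd : ∀ x, x ∈ L ↔ x ∈ L.direction := fun x => by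
      simpa using (AffineSubspace.vsub_right_mem_direction_iff_mem h0 x).symm
    have hFW : ∀ᶠ t in 𝓝 0, F t ∈ L.direction := hFC.mono fun t ht => (hd _).mp ht
    obtain ⟨haL, hbL⟩ := twoJet_mem_submodule _ hF hFW
    have hspan : ∀ x ∈ L.direction, ∃ k : ℝ, k • a = x := fun x hx => by
      obtain ⟨k, hk⟩ := (finrank_eq_one_iff_of_nonzero' (⟨a, haL⟩ : L.direction)
        (by simpa using ha)).mp hL1 ⟨x, hx⟩
      exact ⟨k, congrArg Subtype.val hk⟩
    obtain ⟨β, rfl⟩ := hspan b hbL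
    filter_upwards [hFW] with t ht
    obtain ⟨φ, hφ⟩ := hspan _ ht
    rw [← hφ]
    simp only [inner_smul_left, inner_smul_right, RCLike.conj_to_real]
    module
  · have h0S : (0 : EuclideanSpace ℝ (Fin n)) ∈ S := h0.1
    have hd : ∀ x, x ∈ S ↔ x ∈ S.direction := fun x => by
      simpa using (AffineSubspace.vsub_right_mem_direction_iff_mem h0S x).symm
    have hFW : ∀ᶠ t in 𝓝 0, F t ∈ S.direction := hFC.mono fun t ht => (hd _).mp ht.1
    obtain ⟨haS, hbS⟩ := twoJet_mem_submodule _ hF hFW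
    have hcr : ‖c‖ = r := by simpa [dist_eq_norm] using h0.2
    have hc0 : c ≠ 0 := norm_pos_iff.mp (hcr ▸ hr)
    have hsph : ∀ᶠ t in 𝓝 0, (inner ℝ (F t) (F t) : ℝ) = 2 * inner ℝ (F t) c := by
      filter_upwards [hFC] with t ht
      have h1 : ‖F t - c‖ = r := by simpa [dist_eq_norm] using ht.2
      have h2 := norm_sub_sq_real (F t) c
      rw [h1, hcr, ← real_inner_self_eq_norm_sq] at h2
      linarith
    obtain ⟨hac, haa⟩ := twoJet_inner_centre hF hsph
    have haa0 : (inner ℝ a a : ℝ) ≠ 0 := inner_self_ne_zero.mpr ha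
    have hcc0 : (inner ℝ c c : ℝ) ≠ 0 := inner_self_ne_zero.mpr hc0
    -- `a` and `c` are nonzero and orthogonal, hence a basis of the plane. This is the orthogonal
    -- expansion cleared of denominators; a nonzero defect would be a third independent vector.
    have hdecomp : ∀ x ∈ S.direction,
        ((inner ℝ a a : ℝ) * inner ℝ c c) • x =
          ((inner ℝ c c : ℝ) * inner ℝ x a) • a + ((inner ℝ a a : ℝ) * inner ℝ x c) • c := by
      intro x hx
      by_contra hne
      have hy := sub_ne_zero.mpr hne
      set y := ((inner ℝ a a : ℝ) * inner ℝ c c) • x -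
        (((inner ℝ c c : ℝ) * inner ℝ x a) • a + ((inner ℝ a a : ℝ) * inner ℝ x c) • c) with hydef
      have hcS' := (hd c).mp hcS
      have hyS : y ∈ S.direction := S.direction.sub_mem (S.direction.smul_mem _ hx)
        (S.direction.add_mem (S.direction.smul_mem _ haS) (S.direction.smul_mem _ hcS'))
      have hca : inner ℝ c a = 0 := by rw [real_inner_comm, hac]
      have hya : inner ℝ y a = 0 := by
        simp only [hydef, inner_sub_left, inner_add_left, inner_smul_left, RCLike.conj_to_real, hca]
        ring
      have hyc : inner ℝ y c = 0 := by
        simp only [hydef, inner_sub_left, inner_add_left, inner_smul_left, RCLike.conj_to_real, hac]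
        ring
      have hli : LinearIndependent ℝ
          (![⟨a, haS⟩, ⟨c, hcS'⟩, ⟨y, hyS⟩] : Fin 3 → S.direction) := by
        refine linearIndependent_of_ne_zero_of_inner_eq_zero (𝕜 := ℝ) ?_ ?_
        · intro i
          fin_cases i <;> simpa [← Subtype.coe_inj]
        · intro i j hij
          have hay : inner ℝ a y = 0 := by rw [real_inner_comm, hya]
          have hcy : inner ℝ c y = 0 := by rw [real_inner_comm, hyc]
          fin_cases i <;> fin_cases j <;> first | exact absurd rfl hij | simpa
      have := hli.fintype_card_le_finrank
      rw [hS2, Fintype.card_fin] at this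
      omega
    filter_upwards [hFW, hsph] with t ht hts
    have hFt := hdecomp _ ht
    have hb := hdecomp b hbS
    refine smul_right_injective _ hcc0 ?_
    have hbc : (inner ℝ b c : ℝ) = inner ℝ a a / 2 := by linarith
    rw [hbc] at hb
    simp only [hts, real_inner_comm a b] at hb ⊢
    linear_combination (norm := module) (inner ℝ a a : ℝ) • hFt - (2 * inner ℝ (F t) c : ℝ) • hb

/-- The points satisfying the equation of the osculating circle lie in a circle. -/
theorem exists_isCircle_of_osculating {n : ℕ} {a w : EuclideanSpace ℝ (Fin n)} (ha : a ≠ 0)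
    (haw : inner ℝ a w = 0) :
    ∃ C, IsCircle C ∧ ∀ y : EuclideanSpace ℝ (Fin n),
      (inner ℝ a a : ℝ) • y - (inner ℝ y a : ℝ) • a = (inner ℝ y y : ℝ) • w → y ∈ C := by
  have haa0 : (inner ℝ a a : ℝ) ≠ 0 := inner_self_ne_zero.mpr ha
  have hsolve : ∀ y : EuclideanSpace ℝ (Fin n),
      (inner ℝ a a : ℝ) • y - (inner ℝ y a : ℝ) • a = (inner ℝ y y : ℝ) • w →
      y = (inner ℝ y a / inner ℝ a a : ℝ) • a + (inner ℝ y y / inner ℝ a a : ℝ) • w := by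
    intro y hy
    rw [sub_eq_iff_eq_add] at hy
    refine smul_right_injective _ haa0 ?_
    simp only [hy, smul_add, smul_smul, mul_div_cancel₀ _ haa0]
    rw [add_comm]
  rcases eq_or_ne w 0 with rfl | hw
  · refine ⟨_, Or.inr (Or.inl ⟨(Submodule.span ℝ {a}).toAffineSubspace, ⟨0, ?_⟩, ?_, rfl⟩), ?_⟩
    · simp
    · rw [Submodule.toAffineSubspace_direction]
      exact finrank_span_singleton ha
    · intro y hy
      have := hsolve y hy
      rw [smul_zero, add_zero] at this
      rw [this]
      exact Submodule.smul_mem _ _ (Submodule.mem_span_singleton_self a)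
  · have hww0 : (inner ℝ w w : ℝ) ≠ 0 := inner_self_ne_zero.mpr hw
    have ha_mem : a ∈ Submodule.span ℝ {a, w} := Submodule.subset_span (by simp)
    have hw_mem : w ∈ Submodule.span ℝ {a, w} := Submodule.subset_span (by simp)
    -- Pairing the equation with `w ⊥ a` gives `⟨a, a⟩⟨y, w⟩ = ⟨y, y⟩⟨w, w⟩`. This factor turns that
    -- into `⟨y, y⟩ = 2⟨y, c⟩`, the sphere through `0` centred at `c`.
    set c := (inner ℝ a a / (2 * inner ℝ w w) : ℝ) • w with hc
    have hc0 : c ≠ 0 := smul_ne_zero (div_ne_zero haa0 (mul_ne_zero two_ne_zero hww0)) hw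
    refine ⟨_, Or.inr (Or.inr ⟨(Submodule.span ℝ {a, w}).toAffineSubspace, c, ‖c‖,
      Submodule.smul_mem _ _ hw_mem, ?_, norm_pos_iff.mpr hc0, rfl⟩), ?_⟩
    · rw [Submodule.toAffineSubspace_direction]
      have hli : LinearIndependent ℝ ![a, w] := by
        refine linearIndependent_of_ne_zero_of_inner_eq_zero (𝕜 := ℝ) ?_ ?_
        · intro i
          fin_cases i <;> simpa
        · intro i j hij
          have hwa : inner ℝ w a = 0 := by rw [real_inner_comm, haw]
          fin_cases i <;> fin_cases j <;> first | exact absurd rfl hij | simpa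
      have := finrank_span_eq_card hli
      rwa [Matrix.range_cons, Matrix.range_cons, Matrix.range_empty, Set.union_empty,
        Set.singleton_union, Fintype.card_fin] at this
    · intro y hy
      refine ⟨?_, ?_⟩
      · rw [hsolve y hy]
        exact Submodule.add_mem _ (Submodule.smul_mem _ _ ha_mem) (Submodule.smul_mem _ _ hw_mem)
      · have h1 := congrArg (fun z => (inner ℝ z w : ℝ)) hy
        simp only [inner_sub_left, inner_smul_left, RCLike.conj_to_real, haw, mul_zero,
          sub_zero] at h1
        have h2 : (inner ℝ y y : ℝ) = 2 * inner ℝ y c := by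
          rw [hc, inner_smul_right]
          field_simp
          linarith
        rw [mem_sphere_iff_norm, ← sq_eq_sq₀ (norm_nonneg _) (norm_nonneg _), norm_sub_sq_real,
          ← real_inner_self_eq_norm_sq y]
        linarith

/-- The third and fourth order terms of a curve in its osculating circle. -/
theorem osculating_coefficients {F : ℝ → E} {a b c d : E}
    (hF : (fun t => F t - (t • a + t ^ 2 • b + t ^ 3 • c + t ^ 4 • d)) =o[𝓝 0]
      fun t : ℝ => t ^ 4)
    (h : ∀ᶠ t in 𝓝 0, (inner ℝ a a : ℝ) ^ 2 • F t - ((inner ℝ a a : ℝ) * inner ℝ (F t) a) • a =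
      (inner ℝ (F t) (F t) : ℝ) • ((inner ℝ a a : ℝ) • b - (inner ℝ a b : ℝ) • a)) :
    (inner ℝ a a : ℝ) ^ 2 • c - ((inner ℝ a a : ℝ) * inner ℝ c a) • a =
      (2 * inner ℝ a b : ℝ) • ((inner ℝ a a : ℝ) • b - (inner ℝ a b : ℝ) • a) ∧
    (inner ℝ a a : ℝ) ^ 2 • d - ((inner ℝ a a : ℝ) * inner ℝ d a) • a =
      (inner ℝ b b + 2 * inner ℝ a c : ℝ) •
        ((inner ℝ a a : ℝ) • b - (inner ℝ a b : ℝ) • a) := by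
  set w := (inner ℝ a a : ℝ) • b - (inner ℝ a b : ℝ) • a with hw
  set P : ℝ → E := fun t => t • a + t ^ 2 • b + t ^ 3 • c + t ^ 4 • d with hP
  have hg : (fun t : ℝ => t ^ 4) =O[𝓝 0] fun _ => (1 : ℝ) :=
    (by fun_prop : Continuous fun t : ℝ => t ^ 4).continuousAt.isBigO_one ℝ
  have hPO : P =O[𝓝 0] fun _ => (1 : ℝ) := (by fun_prop : Continuous P).continuousAt.isBigO_one ℝ
  have hq : (fun t => (inner ℝ (F t) (F t) - inner ℝ (P t) (P t) : ℝ) • w) =o[𝓝 0]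
      fun t : ℝ => t ^ 4 := by
    simpa using (inner_self_sub_inner_self_isLittleO hF hg hPO).smul_isBigO
      (isBigO_const_const w (one_ne_zero (α := ℝ)) (𝓝 (0 : ℝ)))
  have hT := (((inner ℝ a a : ℝ) ^ 2 • ContinuousLinearMap.id ℝ E -
    (inner ℝ a a : ℝ) • (innerSL ℝ a).smulRight a).isBigO_comp (fun t => F t - P t)
      (𝓝 0)).trans_isLittleO hF
  -- These are the terms of `⟨P, P⟩ w` of order five and higher.
  have hr : (fun t : ℝ => t ^ 5 • (2 * inner ℝ a d + 2 * inner ℝ b c +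
      t * (inner ℝ c c + 2 * inner ℝ b d) + t ^ 2 * (2 * inner ℝ c d) +
      t ^ 3 * inner ℝ d d : ℝ) • w) =o[𝓝 0] fun t : ℝ => t ^ 4 := by
    simpa using (isLittleO_pow_pow (𝕜 := ℝ) (show 4 < 5 by norm_num)).smul_isBigO
      ((by fun_prop : Continuous fun t : ℝ => (2 * inner ℝ a d + 2 * inner ℝ b c +
      t * (inner ℝ c c + 2 * inner ℝ b d) + t ^ 2 * (2 * inner ℝ c d) +
      t ^ 3 * inner ℝ d d : ℝ) • w).continuousAt.isBigO_one ℝ)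
  have key : (fun t : ℝ => t ^ 3 • ((inner ℝ a a : ℝ) ^ 2 • c -
      ((inner ℝ a a : ℝ) * inner ℝ c a) • a - (2 * inner ℝ a b : ℝ) • w) +
      t ^ (3 + 1) • ((inner ℝ a a : ℝ) ^ 2 • d - ((inner ℝ a a : ℝ) * inner ℝ d a) • a -
      (inner ℝ b b + 2 * inner ℝ a c : ℝ) • w)) =o[𝓝 0] fun t : ℝ => t ^ (3 + 1) := by
    refine ((hq.sub hT).add hr).congr' ?_ EventuallyEq.rfl
    filter_upwards [h] with t ht
    -- Orders one and two cancel identically: the equation is built from `a` and `b`. Adding back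
    -- the tail removes all orders above four.
    have hTP : (inner ℝ a a : ℝ) ^ 2 • P t - ((inner ℝ a a : ℝ) * inner ℝ (P t) a) • a -
        (inner ℝ (P t) (P t) : ℝ) • w + t ^ 5 • (2 * inner ℝ a d + 2 * inner ℝ b c +
        t * (inner ℝ c c + 2 * inner ℝ b d) + t ^ 2 * (2 * inner ℝ c d) +
        t ^ 3 * inner ℝ d d : ℝ) • w =
        t ^ 3 • ((inner ℝ a a : ℝ) ^ 2 • c -
        ((inner ℝ a a : ℝ) * inner ℝ c a) • a - (2 * inner ℝ a b : ℝ) • w) +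
        t ^ (3 + 1) • ((inner ℝ a a : ℝ) ^ 2 • d - ((inner ℝ a a : ℝ) * inner ℝ d a) • a -
        (inner ℝ b b + 2 * inner ℝ a c : ℝ) • w) := by
      simp only [hP, hw, inner_add_right, inner_add_left, inner_smul_left, inner_smul_right,
        RCLike.conj_to_real, real_inner_comm a b, real_inner_comm a c, real_inner_comm a d,
        real_inner_comm b c, real_inner_comm b d, real_inner_comm c d]
      module
    rw [← hTP]
    simp only [sub_apply, smul_apply,
      ContinuousLinearMap.id_apply, ContinuousLinearMap.smulRight_apply, innerSL_apply_apply,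
      inner_sub_right, real_inner_comm (F t) a, real_inner_comm (P t) a]
    linear_combination (norm := module) -ht
  obtain ⟨h3, h4⟩ := eq_zero_of_pow_smul_add_pow_smul_isLittleO key
  exact ⟨sub_eq_zero.mp h3, sub_eq_zero.mp h4⟩

end Circle

/-! ### Polynomial maps and jets of analytic germs -/

variable {m n : ℕ}

/-- The map into Euclidean space with given polynomial coordinates. -/
noncomputable def polyMap (f : Fin n → MvPolynomial (Fin m) ℝ) (x : EuclideanSpace ℝ (Fin m)) :
    EuclideanSpace ℝ (Fin n) :=
  WithLp.toLp 2 fun i => MvPolynomial.eval (fun j => x j) (f i)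

@[simp]
theorem polyMap_apply (f : Fin n → MvPolynomial (Fin m) ℝ) (x : EuclideanSpace ℝ (Fin m))
    (i : Fin n) : polyMap f x i = MvPolynomial.eval (fun j => x j) (f i) := rfl

theorem inner_polyMap (f g : Fin n → MvPolynomial (Fin m) ℝ) (x : EuclideanSpace ℝ (Fin m)) :
    inner ℝ (polyMap f x) (polyMap g x) = MvPolynomial.eval (fun j => x j) (f ⬝ᵥ g) := by
  simp [PiLp.inner_apply, dotProduct, mul_comm]

theorem analyticAt_eval (f : MvPolynomial (Fin m) ℝ) (x : EuclideanSpace ℝ (Fin m)) :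
    AnalyticAt ℝ (fun y : EuclideanSpace ℝ (Fin m) => MvPolynomial.eval (fun j => y j) f) x := by
  exact AnalyticOnNhd.eval_continuousLinearMap'
    (fun j => (EuclideanSpace.proj j : EuclideanSpace ℝ (Fin m) →L[ℝ] ℝ)) f x trivial

theorem analyticAt_polyMap (f : Fin n → MvPolynomial (Fin m) ℝ) (x : EuclideanSpace ℝ (Fin m)) :
    AnalyticAt ℝ (polyMap f) x :=
  ((EuclideanSpace.equiv (Fin n) ℝ).symm.toContinuousLinearMap.analyticAt _).comp
    (AnalyticAt.pi fun i => analyticAt_eval (f i) x)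

/-- The homogeneous terms up to order four of an analytic germ, as polynomials. -/
theorem AnalyticAt.exists_polyMap_jet {Φ : EuclideanSpace ℝ (Fin m) → EuclideanSpace ℝ (Fin n)}
    (hΦ : AnalyticAt ℝ Φ 0) (h0 : Φ 0 = 0) :
    ∃ a b c d : Fin n → MvPolynomial (Fin m) ℝ,
      (∀ i, (a i).IsHomogeneous 1) ∧ (∀ i, (b i).IsHomogeneous 2) ∧
      (∀ x, fderiv ℝ Φ 0 x = polyMap a x) ∧
      (fun x => Φ x - (polyMap a x + polyMap b x)) =o[𝓝 0] (fun x => ‖x‖ ^ 2) ∧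
      ∀ x, (fun t : ℝ => Φ (t • x) - (t • polyMap a x + t ^ 2 • polyMap b x +
        t ^ 3 • polyMap c x + t ^ 4 • polyMap d x)) =o[𝓝 0] fun t : ℝ => t ^ 4 := by
  obtain ⟨P, hP⟩ := hΦ
  choose f hf hPf using fun k => MvPolynomial.exists_eval_eq_of_continuousMultilinearMap (P k)
  have hPf' : ∀ k x, P k (fun _ => x) = polyMap (f k) x := fun k x => by
    ext i
    exact hPf k x i
  have hP0 : ∀ x, P 0 x = 0 := fun x => (hP.coeff_zero x).trans h0
  have hf0 : ∀ x, polyMap (f 0) x = 0 := fun x => by rw [← hPf', hP0]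
  have hsmul : ∀ k (t : ℝ) x, P k (fun _ => t • x) = t ^ k • polyMap (f k) x := fun k t x => by
    have := (P k).map_smul_univ (fun _ => t) (fun _ => x)
    simpa [hPf'] using this
  refine ⟨f 1, f 2, f 3, f 4, hf 1, hf 2, fun x => ?_, ?_, fun x => ?_⟩
  · rw [hP.fderiv_eq, ← hPf']
    exact congrArg (P 1) (funext fun i => by rw [Fin.fin_one_eq_zero i]; rfl)
  -- A partial sum of index `k` stops at degree `k - 1`: index 3 gives the two-jet, and index 5
  -- below gives the four-jet.
  · have h := hP.isBigO_sub_partialSum_pow 3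
    simp only [FormalMultilinearSeries.partialSum, Finset.sum_range_succ, Finset.sum_range_zero,
      zero_add, hPf', hf0] at h
    refine h.trans_isLittleO ?_
    exact (isLittleO_pow_pow (𝕜 := ℝ) (show 2 < 3 by norm_num)).comp_tendsto tendsto_norm_zero
  · have h := hP.isBigO_sub_partialSum_pow 5
    have ht : Tendsto (fun t : ℝ => t • x) (𝓝 0) (𝓝 0) := by
      simpa using (by fun_prop : Continuous fun t : ℝ => t • x).tendsto 0
    have h' := h.comp_tendsto ht
    simp only [FormalMultilinearSeries.partialSum, Finset.sum_range_succ, Finset.sum_range_zero,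
      zero_add, hP0, Function.comp_def, hsmul, pow_one] at h'
    refine h'.trans_isLittleO ?_
    simp only [norm_smul, mul_pow]
    have := (isLittleO_pow_pow (𝕜 := ℝ) (show 4 < 5 by norm_num)).norm_left.mul_isBigO
      (isBigO_const_const (‖x‖ ^ 5) (one_ne_zero (α := ℝ)) (𝓝 (0 : ℝ)))
    simpa [norm_pow] using this

/-- The restriction of a two-jet to a line. -/
theorem HasTwoJet.comp_line {Φ : EuclideanSpace ℝ (Fin m) → EuclideanSpace ℝ (Fin n)}
    {A : EuclideanSpace ℝ (Fin m) →ₗ[ℝ] EuclideanSpace ℝ (Fin n)}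
    {B : QuadraticMap ℝ (EuclideanSpace ℝ (Fin m)) (EuclideanSpace ℝ (Fin n))}
    (h : HasTwoJet Φ A B) (x : EuclideanSpace ℝ (Fin m)) :
    (fun t : ℝ => Φ (t • x) - (t • A x + t ^ 2 • B x)) =o[𝓝 0] fun t : ℝ => t ^ 2 := by
  have ht : Tendsto (fun t : ℝ => t • x) (𝓝 0) (𝓝 0) := by
    simpa using (by fun_prop : Continuous fun t : ℝ => t • x).tendsto 0
  have h' := IsLittleO.comp_tendsto h ht
  simp only [Function.comp_def, map_smul, QuadraticMap.map_smul, norm_smul, mul_pow,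
    Real.norm_eq_abs, sq_abs, ← pow_two] at h'
  refine h'.trans_isBigO ?_
  simpa using (isBigO_refl (fun t : ℝ => t ^ 2) (𝓝 0)).mul
    (isBigO_const_const (‖x‖ ^ 2) (one_ne_zero (α := ℝ)) (𝓝 (0 : ℝ)))

/-- A two-jet has at most one pair of linear and quadratic terms along each line. -/
theorem twoJet_unique {E : Type*} [NormedAddCommGroup E] [NormedSpace ℝ E] {F : ℝ → E}
    {a b a' b' : E} (h : (fun t => F t - (t • a + t ^ 2 • b)) =o[𝓝 0] fun t : ℝ => t ^ 2)
    (h' : (fun t => F t - (t • a' + t ^ 2 • b')) =o[𝓝 0] fun t : ℝ => t ^ 2) :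
    a = a' ∧ b = b' := by
  have := eq_zero_of_pow_smul_add_pow_smul_isLittleO (k := 1) (v := a - a') (w := b - b')
    ((h'.sub h).congr_left fun t => by module)
  exact ⟨sub_eq_zero.mp this.1, sub_eq_zero.mp this.2⟩

/-- Along lines, a rounding satisfies the equation of the osculating circle. -/
theorem IsRounding.eventually_osculating
    {Φ : EuclideanSpace ℝ (Fin m) → EuclideanSpace ℝ (Fin n)} (hΦ : IsRounding Φ)
    {x : EuclideanSpace ℝ (Fin m)} {a b : EuclideanSpace ℝ (Fin n)}
    (h : (fun t : ℝ => Φ (t • x) - (t • a + t ^ 2 • b)) =o[𝓝 0] fun t : ℝ => t ^ 2) :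
    ∀ᶠ t : ℝ in 𝓝 0,
      (inner ℝ a a : ℝ) ^ 2 • Φ (t • x) - ((inner ℝ a a : ℝ) * inner ℝ (Φ (t • x)) a) • a =
        (inner ℝ (Φ (t • x)) (Φ (t • x)) : ℝ) •
          ((inner ℝ a a : ℝ) • b - (inner ℝ a b : ℝ) • a) := by
  rcases eq_or_ne x 0 with rfl | hx
  · simp [hΦ.2.1]
  · obtain ⟨C, hC, hΦC⟩ := hΦ.2.2 x hx
    exact hC.eventually_osculating (F := fun t => Φ (t • x)) h hΦC (by simp [hΦ.2.1])

/-! ### The fractional quadratic model -/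

/-- With `κ` the denominator, `hp` and `hq` make the squared norm of the numerator `κ t² ⟨A x, A
x⟩`, so one factor `κ` cancels. On the left, all multiples of `A x` drop out and only `t² B x / κ`
contributes. -/
theorem quadraticModel_osculating
    {A : EuclideanSpace ℝ (Fin m) →ₗ[ℝ] EuclideanSpace ℝ (Fin n)}
    {B : QuadraticMap ℝ (EuclideanSpace ℝ (Fin m)) (EuclideanSpace ℝ (Fin n))}
    {p : EuclideanSpace ℝ (Fin m) →ₗ[ℝ] ℝ} {q : QuadraticForm ℝ (EuclideanSpace ℝ (Fin m))}
    {x : EuclideanSpace ℝ (Fin m)} (hp : inner ℝ (A x) (B x) = p x * inner ℝ (A x) (A x))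
    (hq : inner ℝ (B x) (B x) = q x * inner ℝ (A x) (A x)) {t : ℝ}
    (ht : 1 - 2 * p (t • x) + q (t • x) ≠ 0) :
    (inner ℝ (A x) (A x) : ℝ) • quadraticModel A B p q (t • x) -
        (inner ℝ (quadraticModel A B p q (t • x)) (A x) : ℝ) • A x =
      (inner ℝ (quadraticModel A B p q (t • x)) (quadraticModel A B p q (t • x)) : ℝ) •
        (B x - p x • A x) := by
  have hp' : inner ℝ (B x) (A x) = p x * inner ℝ (A x) (A x) := by rw [real_inner_comm, hp]
  rw [quadraticModel]
  set κ := 1 - 2 * p (t • x) + q (t • x) with hκ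
  have hκ' : κ = 1 - 2 * t * p x + t ^ 2 * q x := by
    simp only [hκ, map_smul, QuadraticMap.map_smul, smul_eq_mul]
    ring
  have hyy : (inner ℝ (κ⁻¹ • (A (t • x) + B (t • x) - (2 * p (t • x)) • A (t • x)))
      (κ⁻¹ • (A (t • x) + B (t • x) - (2 * p (t • x)) • A (t • x))) : ℝ) =
      κ⁻¹ * t ^ 2 * inner ℝ (A x) (A x) := by
    simp only [map_smul, QuadraticMap.map_smul, inner_add_right, inner_add_left, inner_sub_left,
      inner_sub_right, inner_smul_left, inner_smul_right, RCLike.conj_to_real, hp, hp', hq,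
      smul_eq_mul]
    field_simp
    rw [hκ']
    ring
  rw [hyy]
  simp only [map_smul, QuadraticMap.map_smul, inner_add_left, inner_sub_left, inner_smul_left,
    RCLike.conj_to_real, hp', smul_eq_mul]
  module

theorem exists_twoJet {Φ : EuclideanSpace ℝ (Fin m) → EuclideanSpace ℝ (Fin n)}
    (hΦ : AnalyticAt ℝ Φ 0) (h0 : Φ 0 = 0) :
    ∃ (A : EuclideanSpace ℝ (Fin m) →ₗ[ℝ] EuclideanSpace ℝ (Fin n))
      (B : QuadraticMap ℝ (EuclideanSpace ℝ (Fin m)) (EuclideanSpace ℝ (Fin n))),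
      HasTwoJet Φ A B := by
  obtain ⟨a, b, c, d, ha, hb, hfd, hjet, -⟩ := hΦ.exists_polyMap_jet h0
  choose q hq using fun i => (hb i).exists_quadraticForm
  refine ⟨(fderiv ℝ Φ 0).toLinearMap,
    ∑ i, (LinearMap.toSpanSingleton ℝ _ (EuclideanSpace.single i (1 : ℝ))).compQuadraticMap (q i),
    hjet.congr_left fun x => ?_⟩
  have : polyMap b x = ∑ i, q i x • EuclideanSpace.single i (1 : ℝ) := by
    ext l
    simp [hq, Pi.single_apply]
  simp [hfd, this]

/-- The denominator is `1` at `0` and the numerator has linear part `A`, so the differential is `A`;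
differentiating along lines suffices. -/
theorem rankAtZero_quadraticModel
    {A : EuclideanSpace ℝ (Fin m) →ₗ[ℝ] EuclideanSpace ℝ (Fin n)}
    {B : QuadraticMap ℝ (EuclideanSpace ℝ (Fin m)) (EuclideanSpace ℝ (Fin n))}
    {p : EuclideanSpace ℝ (Fin m) →ₗ[ℝ] ℝ} {q : QuadraticForm ℝ (EuclideanSpace ℝ (Fin m))}
    (h : DifferentiableAt ℝ (quadraticModel A B p q) 0) :
    rankAtZero (quadraticModel A B p q) = Module.finrank ℝ (LinearMap.range A) := by
  have : (fderiv ℝ (quadraticModel A B p q) 0).toLinearMap = A := by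
    ext1 x
    have h1 := h.hasFDerivAt.hasLineDerivAt x
    have h2 : HasDerivAt (fun t : ℝ => (1 - 2 * (t * p x) + t ^ 2 * q x)⁻¹ •
        (t • A x + t ^ 2 • B x - (2 * (t * p x)) • t • A x)) (A x) 0 := by
      have h3 : HasDerivAt (fun t : ℝ => t) 1 0 := hasDerivAt_id 0
      have hn := ((h3.smul_const (A x)).add ((h3.pow 2).smul_const (B x))).sub
        (((h3.mul_const (p x)).const_mul 2).smul (h3.smul_const (A x)))
      have hd := (((h3.mul_const (p x)).const_mul 2).const_sub 1).add
        ((h3.pow 2).mul_const (q x))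
      have := (hd.inv (by simp)).smul hn
      exact this.congr_deriv (by simp)
    refine HasDerivAt.unique h1 (h2.congr_of_eventuallyEq (.of_forall fun t => ?_))
    simp [quadraticModel, QuadraticMap.map_smul, pow_two]
  rw [rankAtZero, this]

/-! ### Assembly of the theorem -/

/-- The divisibility of `⟨A, B⟩` and `⟨B, B⟩` by `⟨A, A⟩` for the two-jet of a rounding of rank at
least two. -/
theorem IsRounding.exists_polynomial_quotients
    {Φ : EuclideanSpace ℝ (Fin m) → EuclideanSpace ℝ (Fin n)} (hΦ : IsRounding Φ)
    (hrank : 2 ≤ rankAtZero Φ)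
    {A : EuclideanSpace ℝ (Fin m) →ₗ[ℝ] EuclideanSpace ℝ (Fin n)}
    {B : QuadraticMap ℝ (EuclideanSpace ℝ (Fin m)) (EuclideanSpace ℝ (Fin n))}
    (hAB : HasTwoJet Φ A B) :
    2 ≤ Module.finrank ℝ (LinearMap.range A) ∧
    ∃ (a b : Fin n → MvPolynomial (Fin m) ℝ) (p q : MvPolynomial (Fin m) ℝ),
      (∀ i, (a i).IsHomogeneous 1) ∧ (∀ i, (b i).IsHomogeneous 2) ∧
      p.IsHomogeneous 1 ∧ q.IsHomogeneous 2 ∧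
      (∀ x, A x = polyMap a x) ∧ (∀ x, B x = polyMap b x) ∧
      a ⬝ᵥ b = (a ⬝ᵥ a) * p ∧ b ⬝ᵥ b = (a ⬝ᵥ a) * q := by
  obtain ⟨a, b, c, d, ha, hb, hfd, -, hjet⟩ := hΦ.1.exists_polyMap_jet hΦ.2.1
  have hjet2 : ∀ x, (fun t : ℝ => Φ (t • x) - (t • polyMap a x + t ^ 2 • polyMap b x)) =o[𝓝 0]
      fun t : ℝ => t ^ 2 := fun x => by
    have h4 : (fun t : ℝ => t ^ 4) =o[𝓝 0] fun t : ℝ => t ^ 2 :=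
      isLittleO_pow_pow (by norm_num)
    have h3 : (fun t : ℝ => t ^ 3 • (polyMap c x + t • polyMap d x)) =o[𝓝 0]
        fun t : ℝ => t ^ 2 := by
      simpa using (isLittleO_pow_pow (𝕜 := ℝ) (show 2 < 3 by norm_num)).smul_isBigO
        ((by fun_prop : Continuous fun t : ℝ =>
          polyMap c x + t • polyMap d x).continuousAt.isBigO_one ℝ)
    exact (((hjet x).trans h4).add h3).congr_left fun t => by module
  have hAa : ∀ x, A x = polyMap a x := fun x => (twoJet_unique (hAB.comp_line x) (hjet2 x)).1
  have hBb : ∀ x, B x = polyMap b x := fun x => (twoJet_unique (hAB.comp_line x) (hjet2 x)).2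
  have hrankA : 2 ≤ Module.finrank ℝ (LinearMap.range A) := by
    have : (fderiv ℝ Φ 0).toLinearMap = A := by
      ext1 x
      exact (hfd x).trans (hAa x).symm
    rwa [rankAtZero, this] at hrank
  have hcoef := fun x => osculating_coefficients (F := fun t => Φ (t • x)) (hjet x)
    (hΦ.eventually_osculating (hjet2 x))
  simp only [inner_polyMap] at hcoef
  have hhom : ∀ {i j : ℕ} {f g : Fin n → MvPolynomial (Fin m) ℝ}, (∀ l, (f l).IsHomogeneous i) →
      (∀ l, (g l).IsHomogeneous j) → (f ⬝ᵥ g).IsHomogeneous (i + j) := fun hf hg =>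
    MvPolynomial.IsHomogeneous.sum _ _ _ fun l _ => (hf l).mul (hg l)
  have hprime : Prime (a ⬝ᵥ a) := MvPolynomial.prime_of_eval_eq_inner_self (hhom ha ha) A hrankA
    fun x => by rw [hAa, inner_polyMap]
  obtain ⟨i₀, hi₀⟩ : ∃ i, a i ≠ 0 := by
    by_contra! h
    exact hprime.ne_zero (Finset.sum_eq_zero fun i _ => by rw [h i, zero_mul])
  -- A nonzero linear form is not a multiple of a polynomial of degree two.
  have hndvd : ¬ a ⬝ᵥ a ∣ a i₀ := by
    rintro ⟨g, hg⟩
    have hg0 : g ≠ 0 := by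
      rintro rfl
      exact hi₀ (by rw [hg, mul_zero])
    have h1 := MvPolynomial.totalDegree_mul_of_isDomain hprime.ne_zero hg0
    rw [← hg, (ha i₀).totalDegree hi₀, (hhom ha ha).totalDegree hprime.ne_zero] at h1
    omega
  have h2 : ¬ a ⬝ᵥ a ∣ 2 := fun h => hprime.not_isUnit (isUnit_of_dvd_unit h 
    ((IsUnit.mk0 (2 : ℝ) two_ne_zero).map (MvPolynomial.C : ℝ →+* MvPolynomial (Fin m) ℝ)))
  -- The identities hold at every real point, so they hold between polynomials.
  obtain ⟨hdab, hdbb⟩ := dvd_dotProduct_of_circle_conditions (b := b) (c := c) (d := d) hprime h2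
    hndvd (fun i => MvPolynomial.funext fun x => by
      simpa [mul_assoc] using congrArg (fun v => v i) (hcoef (WithLp.toLp 2 x)).1)
    (fun i => MvPolynomial.funext fun x => by
      simpa [mul_assoc] using congrArg (fun v => v i) (hcoef (WithLp.toLp 2 x)).2)
  have hab3 := hhom ha hb
  have hbb4 := hhom hb hb
  obtain ⟨p, hp, hab⟩ := (hhom ha ha).exists_eq_mul_of_dvd (j := 1) hab3 hdab
  obtain ⟨q, hq, hbb⟩ := (hhom ha ha).exists_eq_mul_of_dvd (j := 2) hbb4 hdbb
  exact ⟨hrankA, a, b, p, q, ha, hb, hp, hq, hAa, hBb, hab, hbb⟩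

theorem IsRounding.exists_quadraticModel
    {Φ : EuclideanSpace ℝ (Fin m) → EuclideanSpace ℝ (Fin n)} (hΦ : IsRounding Φ)
    (hrank : 2 ≤ rankAtZero Φ)
    {A : EuclideanSpace ℝ (Fin m) →ₗ[ℝ] EuclideanSpace ℝ (Fin n)}
    {B : QuadraticMap ℝ (EuclideanSpace ℝ (Fin m)) (EuclideanSpace ℝ (Fin n))}
    (hAB : HasTwoJet Φ A B) :
    ∃ (p : EuclideanSpace ℝ (Fin m) →ₗ[ℝ] ℝ) (q : QuadraticForm ℝ (EuclideanSpace ℝ (Fin m))),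
      (∀ x, inner ℝ (A x) (B x) = p x * inner ℝ (A x) (A x)) ∧
      (∀ x, inner ℝ (B x) (B x) = q x * inner ℝ (A x) (A x)) ∧
      IsRounding (quadraticModel A B p q) ∧
      2 ≤ rankAtZero (quadraticModel A B p q) ∧
      IsFractionalQuadratic (quadraticModel A B p q) ∧
      RoundingEquiv Φ (quadraticModel A B p q) := by
  obtain ⟨hrankA, a, b, p', q', ha, hb, hp', hq', hAa, hBb, hab, hbb⟩ :=
    hΦ.exists_polynomial_quotients hrank hAB
  obtain ⟨p, hp⟩ := hp'.exists_linearForm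
  obtain ⟨q, hq⟩ := hq'.exists_quadraticForm
  have hpA : ∀ x, inner ℝ (A x) (B x) = p x * inner ℝ (A x) (A x) := fun x => by
    rw [hAa, hBb, inner_polyMap, inner_polyMap, hab, map_mul, hp, mul_comm]
  have hqA : ∀ x, inner ℝ (B x) (B x) = q x * inner ℝ (A x) (A x) := fun x => by
    rw [hAa, hBb, inner_polyMap, inner_polyMap, hbb, map_mul, hq, mul_comm]
  set P : Fin n → MvPolynomial (Fin m) ℝ := fun i => a i + b i - MvPolynomial.C 2 * p' * a i
    with hP
  set Q : MvPolynomial (Fin m) ℝ := 1 - MvPolynomial.C 2 * p' + q' with hQ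
  have hQx : ∀ x : EuclideanSpace ℝ (Fin m),
      MvPolynomial.eval (fun j => x j) Q = 1 - 2 * p x + q x := fun x => by simp [hQ, hp, hq]
  have hPx : ∀ x, polyMap P x = A x + B x - (2 * p x) • A x := fun x => by
    ext i
    simp [hP, hAa, hBb, hp]
  have hΨ : quadraticModel A B p q = fun x : EuclideanSpace ℝ (Fin m) =>
      (MvPolynomial.eval (fun j => x j) Q)⁻¹ • polyMap P x := by
    funext x
    rw [quadraticModel, hQx, hPx]
  have hQ0 : MvPolynomial.eval (fun j => (0 : EuclideanSpace ℝ (Fin m)) j) Q ≠ 0 := by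
    rw [hQx]
    simp
  have hanalytic : AnalyticAt ℝ (quadraticModel A B p q) 0 := by
    rw [hΨ]
    exact ((analyticAt_eval Q 0).inv hQ0).smul (analyticAt_polyMap P 0)
  have hzero : quadraticModel A B p q 0 = 0 := by simp [quadraticModel]
  have hequiv : RoundingEquiv Φ (quadraticModel A B p q) := by
    intro v hv
    have hΦC := hΦ.eventually_osculating (hAB.comp_line v)
    -- If `A v = 0`, then `B v = 0` and the model is constantly `0` on the line, so any circle
    -- containing the image under `Φ` works. Otherwise both curves satisfy the same equation with `w
    -- = B v - p v • A v`.
    rcases eq_or_ne (A v) 0 with hA0 | hA0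
    · obtain ⟨C, hC, hC'⟩ := hΦ.2.2 v hv
      refine ⟨C, hC, hC', .of_forall fun t => ?_⟩
      have hB0 : B v = 0 := by
        rw [← inner_self_eq_zero (𝕜 := ℝ), hqA, hA0, inner_zero_left, mul_zero]
      have h0 : (0 : EuclideanSpace ℝ (Fin n)) ∈ C := by
        simpa [hΦ.2.1] using hC'.self_of_nhds
      simpa [quadraticModel, hA0, hB0, QuadraticMap.map_smul] using h0
    · have hk : (inner ℝ (A v) (A v) : ℝ) ≠ 0 := inner_self_ne_zero.mpr hA0
      obtain ⟨C, hC, hmem⟩ := exists_isCircle_of_osculating (a := A v) (w := B v - p v • A v) hA0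
        (by rw [inner_sub_right, inner_smul_right, hpA, sub_self])
      refine ⟨C, hC, ?_, ?_⟩
      · filter_upwards [hΦC] with t ht
        refine hmem _ (smul_right_injective _ hk ?_)
        rw [hpA] at ht
        -- After `⟨A v, B v⟩ = p v ⟨A v, A v⟩` is inserted, the equation for `Φ` is `⟨A v, A v⟩`
        -- times the desired one.
        linear_combination (norm := module) ht
      · have hcont : ContinuousAt (fun t : ℝ =>
            MvPolynomial.eval (fun j => (t • v : EuclideanSpace ℝ (Fin m)) j) Q) 0 := by
          refine ContinuousAt.comp (f := fun t : ℝ => t • v)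
            (g := fun x : EuclideanSpace ℝ (Fin m) => MvPolynomial.eval (fun j => x j) Q) ?_
            (by fun_prop)
          exact (analyticAt_eval Q _).continuousAt
        have hne := hcont.eventually_ne (by simpa using hQ0)
        filter_upwards [hne] with t ht
        rw [hQx] at ht
        exact hmem _ (quadraticModel_osculating (hpA v) (hqA v) ht)
  refine ⟨p, q, hpA, hqA, ⟨hanalytic, hzero, fun v hv => ?_⟩, ?_, ?_, hequiv⟩
  · obtain ⟨C, hC, -, h⟩ := hequiv v hv
    exact ⟨C, hC, h⟩
  · rwa [rankAtZero_quadraticModel hanalytic.differentiableAt]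
  · have h2p : (MvPolynomial.C 2 * p').totalDegree ≤ 1 := (hp'.C_mul 2).totalDegree_le
    refine ⟨P, Q, fun i => ?_, ?_, by simpa using hQ0, .of_forall fun x i => ?_⟩
    · refine (MvPolynomial.totalDegree_sub _ _).trans (max_le
        ((MvPolynomial.totalDegree_add _ _).trans (max_le ?_ (hb i).totalDegree_le)) ?_)
      · exact (ha i).totalDegree_le.trans one_le_two
      · exact ((hp'.C_mul 2).mul (ha i)).totalDegree_le
    · refine (MvPolynomial.totalDegree_add _ _).trans (max_le
        ((MvPolynomial.totalDegree_sub _ _).trans (max_le ?_ ?_)) hq'.totalDegree_le)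
      · simp
      · exact h2p.trans one_le_two
    · rw [hΨ]
      simp [div_eq_inv_mul]

theorem theorem1 {m n : ℕ} (Φ : EuclideanSpace ℝ (Fin m) → EuclideanSpace ℝ (Fin n))
    (hΦ : IsRounding Φ) (hrank : 2 ≤ rankAtZero Φ) :
    (∃ Ψ : EuclideanSpace ℝ (Fin m) → EuclideanSpace ℝ (Fin n),
      IsRounding Ψ ∧ 2 ≤ rankAtZero Ψ ∧ IsFractionalQuadratic Ψ ∧ RoundingEquiv Φ Ψ) ∧
    ∀ (A : EuclideanSpace ℝ (Fin m) →ₗ[ℝ] EuclideanSpace ℝ (Fin n))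
      (B : QuadraticMap ℝ (EuclideanSpace ℝ (Fin m)) (EuclideanSpace ℝ (Fin n))),
      HasTwoJet Φ A B →
      ∃ (p : EuclideanSpace ℝ (Fin m) →ₗ[ℝ] ℝ) (q : QuadraticForm ℝ (EuclideanSpace ℝ (Fin m))),
        (∀ x, inner ℝ (A x) (B x) = p x * inner ℝ (A x) (A x)) ∧
        (∀ x, inner ℝ (B x) (B x) = q x * inner ℝ (A x) (A x)) ∧
        IsRounding (quadraticModel A B p q) ∧
        2 ≤ rankAtZero (quadraticModel A B p q) ∧
        IsFractionalQuadratic (quadraticModel A B p q) ∧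
        RoundingEquiv Φ (quadraticModel A B p q) := by
  refine ⟨?_, fun A B hAB => hΦ.exists_quadraticModel hrank hAB⟩
  obtain ⟨A, B, hAB⟩ := exists_twoJet hΦ.1 hΦ.2.1
  obtain ⟨p, q, -, -, h1, h2, h3, h4⟩ := hΦ.exists_quadraticModel hrank hAB
  exact ⟨_, h1, h2, h3, h4⟩
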